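/- Let $G=(V,E)$ be a finite simple undirected graph with edge weights $w:E\to\mathbb Z$. A perfect matching is a set $M\subseteq E$ such that every vertex is covered by exactly one edge of $M$; for $X\subseteq E$ put $w(X)=\sum_{e\in X}w(e)$. The $\ell$-th smallest perfect matchings, $\ell\ge 1$, are defined recursively: a perfect matching is $\ell$-th smallest if it has minimum weight among all perfect matchings that are not $\ell'$-th smallest for any $1\le\ell'<\ell$ (so the $1$st smallest ones are the minimum-weight perfect matchings). **Theorem.** Let $\ell\ge 1$ be an integer. (a) For every such $G$ and $w$, if $M$ is an $\ell$-th smallest perfect matching of $G$, then there is a set $F\subseteq E$ with $|F|\le 2(\ell-1)$ such that $$w(M)=\min\{\,w(M') : M' \text{ a perfect matching of } G,\ F\subseteq M'\,\},$$ where the minimum is over a non-empty set. (b) Consequently, for every such $G$ and $w$, the following enumeration is correct. For each of the at most $(|E|+1)^{2(\ell-1)}$ sets $F\subseteq E$ with $|F|\le 2(\ell-1)$ that is contained in some perfect matching, compute the minimum weight of a perfect matching containing $F$, and let $C\subseteq\mathbb Z$ be the set of all values obtained. Then, for every $k\in\mathbb Z$, $G$ has an $\ell$-th smallest perfect matching of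 weight $k$ if and only if $k\in C$ and exactly $\ell-1$ elements of $C$ are less than $k$. Moreover, if $k\in\mathbb Z$ is such that every perfect matching of weight $k$ is $\ell'$-th smallest for some $\ell'\le\ell$, then $G$ has a perfect matching of weight $k$ if and only if $k\in C$. (c) The bound $2(\ell-1)$ is tight: there are a finite simple graph $G$, weights $w:E\to\mathbb Z$ and an $\ell$-th smallest perfect matching $M$ of $G$ such that every $F\subseteq E$ for which $w(M)$ is the minimum weight of a perfect matching containing $F$ satisfies $|F|\ge 2(\ell-1)$. -/

import Mathlib

namespace SmallestPM

variable {V : Type*} {G : SimpleGraph V}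

/-- The total weight `w(X)` of a finite set `X` of edges of `G`. -/
def weight (w : G.edgeSet → ℤ) (X : Finset G.edgeSet) : ℤ := ∑ e ∈ X, w e

/-- A set `M` of edges of `G` is a perfect matching if every vertex of `G` is covered by exactly
one edge of `M`. -/
def IsPerfectMatching (M : Finset G.edgeSet) : Prop :=
  ∀ v : V, ∃! e : G.edgeSet, e ∈ M ∧ v ∈ (e : Sym2 V)

/-- `M` is an `ℓ`-th smallest perfect matching: it has minimum weight among all perfect matchings
that are not `ℓ'`-th smallest for any `ℓ' < ℓ`. The count starts at `ℓ = 1` (there is no `0`-th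
smallest perfect matching), so for `ℓ = 1` these are the minimum-weight perfect matchings. -/
def IsSmallest (w : G.edgeSet → ℤ) (ℓ : ℕ) (M : Finset G.edgeSet) : Prop :=
  1 ≤ ℓ ∧
  (IsPerfectMatching M ∧ ∀ ℓ' : ℕ, (_ : ℓ' < ℓ) → ¬ IsSmallest w ℓ' M) ∧
  ∀ M' : Finset G.edgeSet,
    (IsPerfectMatching M' ∧ ∀ ℓ' : ℕ, (_ : ℓ' < ℓ) → ¬ IsSmallest w ℓ' M') →
      weight w M ≤ weight w M'
termination_by ℓ

/-- The weights of the perfect matchings that include all of `F`. -/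
def weightsContaining (w : G.edgeSet → ℤ) (F : Finset G.edgeSet) : Set ℤ :=
  {k | ∃ M : Finset G.edgeSet, IsPerfectMatching M ∧ F ⊆ M ∧ weight w M = k}

/-- The weights found when a minimum-weight perfect matching including `F` is computed for every
edge set `F` with at most `s` edges that is contained in some perfect matching. -/
def minWeights (w : G.edgeSet → ℤ) (s : ℕ) : Set ℤ :=
  {k | ∃ F : Finset G.edgeSet, F.card ≤ s ∧ IsLeast (weightsContaining w F) k}

/-- The `1`st smallest perfect matchings are exactly the minimum-weight perfect matchings. -/
theorem isSmallest_one_iff (w : G.edgeSet → ℤ) (M : Finset G.edgeSet) :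
    IsSmallest w 1 M ↔ IsPerfectMatching M ∧
      ∀ M' : Finset G.edgeSet, IsPerfectMatching M' → weight w M ≤ weight w M' := by
  have h0 : ∀ N : Finset G.edgeSet, ¬ IsSmallest w 0 N := by
    intro N h
    rw [IsSmallest] at h
    exact absurd h.1 (by norm_num)
  rw [IsSmallest]
  simp [h0]

/-- The edge sets of perfect matchings in the sense of Mathlib are exactly the perfect matchings
in the present sense. -/
theorem isPerfectMatching_iff (H : G.Subgraph) (hH : H.IsSpanning) (M : Finset G.edgeSet)
    (hM : ∀ e : G.edgeSet, e ∈ M ↔ (e : Sym2 V) ∈ H.edgeSet) :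
    IsPerfectMatching M ↔ H.IsPerfectMatching := by
  rw [SimpleGraph.Subgraph.isPerfectMatching_iff]
  refine forall_congr' fun v => ⟨?_, ?_⟩
  · rintro ⟨⟨e, he⟩, ⟨heM, hv⟩, huniq⟩
    obtain ⟨u, rfl⟩ := Sym2.mem_iff_exists.1 hv
    refine ⟨u, by simpa using (hM _).1 heM, fun y hy => ?_⟩
    have := huniq ⟨s(v, y), H.adj_sub hy⟩ ⟨(hM _).2 (by simpa using hy), by simp⟩
    exact Sym2.congr_right.1 (congrArg Subtype.val this)
  · rintro ⟨u, hu, huniq⟩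
    refine ⟨⟨s(v, u), H.adj_sub hu⟩, ⟨(hM _).2 (by simpa using hu), by simp⟩, ?_⟩
    rintro ⟨e, he⟩ ⟨heM, hv⟩
    obtain ⟨y, rfl⟩ := Sym2.mem_iff_exists.1 hv
    have := huniq y (by simpa using (hM _).1 heM)
    simp [this]

end SmallestPM

/-! Call the rank of a weight the number of distinct perfect-matching weights below it; the `ℓ`-th
smallest matchings are those of rank `ℓ - 1` (`isSmallest_iff`). Part (a) is greedy
(`exists_subset_le_rank`). Start with `F = ∅`. As long as the lightest matchings containing `F` are
lighter than `M`, add two edges of `M` that lie together in none of them. Each round raises the rank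
of the minimum, so `ℓ - 1` rounds suffice.

That such a pair exists is polyhedral (`IsMatchingOf.sum_le_of_pairs`). Otherwise every pair of
edges of `M` lies in a lightest matching containing `F`; let `x` be the average of these. If an odd
cut is tight for `x`, it is tight for each of them, so no two edges of `M` cross it, and it is tight
for `M`. As `x` is positive on `M`, the point `x + s (x - χ_M)` stays in Edmonds' polytope for small
`s > 0`. It equals `1` on `F`, so a matching in its support contains `F`; if `M` were too heavy, one
of these would be lighter than the minimum.

The polytope theorem (`InPolytope.exists_matching_le`) uses the same push away from a matching,
supplied by Tutte's theorem, and otherwise contracts the two sides of a tight odd cut.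

For (b), the enumerated values are matching weights and include all those of rank at most `ℓ - 1`.
For (c), take `ℓ - 1` disjoint prisms with weight `1` on the rungs. -/

namespace SmallestPM

/-! ### Edmonds' polytope and matchings in the support of its points -/

section Multigraph

open scoped Classical

variable {V E : Type*}

/-- The edge `e` of the multigraph with end maps `a` and `b` has exactly one end in `S`. -/
def Crosses (a b : E → V) (S : Finset V) (e : E) : Prop := ¬ (a e ∈ S ↔ b e ∈ S)

/-- Perfect matchings of the multigraph with end maps `a` and `b`. -/
structure IsMatchingOf (a b : E → V) (N : Finset E) : Prop where
  loop : ∀ e ∈ N, a e ≠ b e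
  deg : ∀ v, ∃! e, e ∈ N ∧ Crosses a b {v} e

/-- The characteristic vector of a set of edges. -/
noncomputable def charVec (N : Finset E) (e : E) : ℝ := if e ∈ N then 1 else 0

lemma charVec_of_mem {N : Finset E} {e : E} (h : e ∈ N) : charVec N e = 1 := if_pos h

lemma charVec_of_notMem {N : Finset E} {e : E} (h : e ∉ N) : charVec N e = 0 := if_neg h

lemma charVec_nonneg (N : Finset E) (e : E) : 0 ≤ charVec N e := by
  unfold charVec
  split_ifs <;> norm_num

lemma crosses_singleton {a b : E → V} {v : V} {e : E} (hab : a e ≠ b e) :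
    Crosses a b {v} e ↔ a e = v ∨ b e = v := by
  simp only [Crosses, Finset.mem_singleton]
  grind

lemma crosses_compl [Fintype V] {a b : E → V} {S : Finset V} {e : E} :
    Crosses a b Sᶜ e ↔ Crosses a b S e := by
  simp only [Crosses, Finset.mem_compl]
  tauto

variable [Fintype E]

/-- The total value of `y` on the edges leaving `S`. -/
noncomputable def cutSum (a b : E → V) (y : E → ℝ) (S : Finset V) : ℝ :=
  ∑ e, if Crosses a b S e then y e else 0

/-- Membership in Edmonds' description of the perfect matching polytope of a multigraph
(loops get value `0`). -/
structure InPolytope (a b : E → V) (y : E → ℝ) : Prop where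
  nonneg : ∀ e, 0 ≤ y e
  loop : ∀ e, a e = b e → y e = 0
  deg : ∀ v, cutSum a b y {v} = 1
  odd : ∀ S : Finset V, Odd S.card → 1 ≤ cutSum a b y S

lemma le_cutSum {a b : E → V} {y : E → ℝ} (hy : ∀ e, 0 ≤ y e) {S : Finset V} {e : E}
    (he : Crosses a b S e) : y e ≤ cutSum a b y S := by
  have := Finset.single_le_sum (f := fun f => if Crosses a b S f then y f else 0)
    (fun f _ => by split_ifs; exacts [hy f, le_rfl]) (Finset.mem_univ e)
  simpa [cutSum, he] using this

lemma sum_mul_charVec (w : E → ℝ) (N : Finset E) : ∑ e, w e * charVec N e = ∑ e ∈ N, w e := by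
  simp [charVec]

lemma cutSum_eq_one_of_existsUnique {a b : E → V} {N : Finset E} {S : Finset V}
    (h : ∃! e, e ∈ N ∧ Crosses a b S e) : cutSum a b (charVec N) S = 1 := by
  obtain ⟨e, ⟨he, hc⟩, hu⟩ := h
  rw [cutSum, Finset.sum_eq_single e]
  · rw [if_pos hc, charVec_of_mem he]
  · intro f _ hf
    by_cases hfc : Crosses a b S f
    · rw [if_pos hfc, charVec_of_notMem fun hfN => hf (hu f ⟨hfN, hfc⟩)]
    · rw [if_neg hfc]
  · simp

lemma sum_mul_combo (w x : E → ℝ) (N : Finset E) (s : ℝ) :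
    ∑ e, w e * (x e + s * (x e - charVec N e)) =
      ∑ e, w e * x e + s * (∑ e, w e * x e - ∑ e ∈ N, w e) := by
  rw [← sum_mul_charVec w N, ← Finset.sum_sub_distrib, Finset.mul_sum, ← Finset.sum_add_distrib]
  exact Finset.sum_congr rfl fun e _ => by ring

lemma cutSum_combo (a b : E → V) (x z : E → ℝ) (s : ℝ) (S : Finset V) :
    cutSum a b (fun e => x e + s * (x e - z e)) S =
      cutSum a b x S + s * (cutSum a b x S - cutSum a b z S) := by
  simp only [cutSum, Finset.mul_sum, ← Finset.sum_sub_distrib, ← Finset.sum_add_distrib]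
  refine Finset.sum_congr rfl fun e _ => ?_
  split_ifs <;> ring

lemma InPolytope.ne_of_pos {a b : E → V} {y : E → ℝ} (h : InPolytope a b y) {e : E}
    (he : 0 < y e) : a e ≠ b e := fun hab => he.ne' (h.loop e hab)

lemma InPolytope.le_one {a b : E → V} {y : E → ℝ} (h : InPolytope a b y) (e : E) : y e ≤ 1 := by
  by_cases hab : a e = b e
  · rw [h.loop e hab]; exact zero_le_one
  · rw [← h.deg (a e)]
    have hc : Crosses a b {a e} e := (crosses_singleton hab).2 (Or.inl rfl)
    exact le_cutSum h.nonneg hc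

variable [Fintype V]

lemma cutSum_compl (a b : E → V) (y : E → ℝ) (S : Finset V) :
    cutSum a b y Sᶜ = cutSum a b y S := by
  simp only [cutSum, crosses_compl]

lemma InPolytope.even_card {a b : E → V} {y : E → ℝ} (h : InPolytope a b y) :
    Even (Fintype.card V) := by
  by_contra hodd
  rw [Nat.not_even_iff_odd] at hodd
  have := h.odd Finset.univ hodd
  norm_num [cutSum, Crosses] at this

/-- The simple graph of the pairs of distinct vertices that are joined by an edge of positive
value. -/
def supportGraph (a b : E → V) (y : E → ℝ) : SimpleGraph V where
  Adj u v := u ≠ v ∧ ∃ e, 0 < y e ∧ s(a e, b e) = s(u, v)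
  symm := ⟨fun _ _ ⟨h, e, he, hs⟩ => ⟨h.symm, e, he, hs.trans Sym2.eq_swap⟩⟩
  loopless := ⟨fun _ h => h.1 rfl⟩

/-- Each odd component left after deleting `U` has cut value at least `1`, all of it on edges ending
in `U`, while the degrees in `U` total `|U|`. So there are at most `|U|` odd components. -/
lemma InPolytope.not_isTutteViolator {a b : E → V} {y : E → ℝ} (h : InPolytope a b y)
    (U : Set V) : ¬ (supportGraph a b y).IsTutteViolator U := by
  rw [SimpleGraph.IsTutteViolator, not_lt]
  set H := ((⊤ : (supportGraph a b y).Subgraph).deleteVerts U).coe with hH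
  have mem_verts : ∀ v, v ∉ U → v ∈ ((⊤ : (supportGraph a b y).Subgraph).deleteVerts U).verts :=
    fun v hv => ⟨trivial, hv⟩
  let S : H.ConnectedComponent → Finset V := fun C =>
    Finset.univ.filter fun v => ∃ hv : v ∉ U, H.connectedComponentMk ⟨v, mem_verts v hv⟩ = C
  have memS : ∀ C v, v ∈ S C ↔ ∃ hv : v ∉ U, H.connectedComponentMk ⟨v, mem_verts v hv⟩ = C :=
    fun C v => by simp [S]
  have cardS : ∀ C, (S C).card = C.supp.ncard := by
    intro C
    rw [← Set.ncard_coe_finset, ← Set.ncard_image_of_injective C.supp Subtype.val_injective]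
    congr 1
    ext v
    simp only [Finset.mem_coe, memS, Set.mem_image, SimpleGraph.ConnectedComponent.mem_supp_iff]
    constructor
    · rintro ⟨hv, hC⟩
      exact ⟨_, hC, rfl⟩
    · rintro ⟨⟨x, hx⟩, hC, rfl⟩
      exact ⟨hx.2, hC⟩
  have key : ∀ e, ∑ C : H.ConnectedComponent, (if Crosses a b (S C) e then y e else 0) ≤
      ∑ u ∈ U.toFinset, if Crosses a b {u} e then y e else 0 := by
    intro e
    rcases (h.nonneg e).eq_or_lt with h0 | hpos
    · simp [← h0]
    have hab := h.ne_of_pos hpos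
    have hR : ∀ u ∈ U.toFinset, 0 ≤ if Crosses a b {u} e then y e else 0 := fun u _ => by
      split_ifs; exacts [hpos.le, le_rfl]
    -- If only the end `p` avoids `U`, then `e` leaves no component but that of `p`, and it is paid
    -- for at its other end `q`.
    have hone : ∀ p q : V, p ∉ U → (∀ C, Crosses a b (S C) e → p ∈ S C) →
        q ∈ U → Crosses a b {q} e →
        ∑ C : H.ConnectedComponent, (if Crosses a b (S C) e then y e else 0) ≤
          ∑ u ∈ U.toFinset, if Crosses a b {u} e then y e else 0 := by
      intro p q hp hC hq hqe
      have h1 := Finset.single_le_sum hR (Set.mem_toFinset.2 hq)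
      rw [if_pos hqe] at h1
      refine le_trans ?_ h1
      rw [Finset.sum_eq_single (H.connectedComponentMk ⟨p, mem_verts p hp⟩)]
      · split_ifs; exacts [le_rfl, hpos.le]
      · intro C _ hne
        refine if_neg fun hCe => hne ?_
        obtain ⟨_, h2⟩ := (memS C p).1 (hC C hCe)
        exact h2.symm
      · simp
    by_cases ha : a e ∈ U <;> by_cases hb : b e ∈ U
    · refine le_trans (le_of_eq (Finset.sum_eq_zero fun C _ => if_neg ?_)) (Finset.sum_nonneg hR)
      have h1 : a e ∉ S C := fun h' => ((memS _ _).1 h').1 ha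
      have h2 : b e ∉ S C := fun h' => ((memS _ _).1 h').1 hb
      simp [Crosses, h1, h2]
    · refine hone (b e) (a e) hb (fun C hC => ?_) ha ((crosses_singleton hab).2 (Or.inl rfl))
      have h1 : a e ∉ S C := fun h' => ((memS _ _).1 h').1 ha
      simpa [Crosses, h1] using hC
    · refine hone (a e) (b e) ha (fun C hC => ?_) hb ((crosses_singleton hab).2 (Or.inr rfl))
      have h1 : b e ∉ S C := fun h' => ((memS _ _).1 h').1 hb
      simpa [Crosses, h1] using hC
    · refine le_trans (le_of_eq (Finset.sum_eq_zero fun C _ => if_neg ?_)) (Finset.sum_nonneg hR)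
      have hadj : H.Adj ⟨a e, mem_verts _ ha⟩ ⟨b e, mem_verts _ hb⟩ := by
        rw [hH, SimpleGraph.Subgraph.coe_adj, SimpleGraph.Subgraph.deleteVerts_adj]
        exact ⟨trivial, ha, trivial, hb, hab, e, hpos, rfl⟩
      have hcomp := SimpleGraph.ConnectedComponent.connectedComponentMk_eq_of_adj hadj
      simp [Crosses, memS, ha, hb, hcomp]
  have h1 : ((H.oddComponents.ncard : ℕ) : ℝ) ≤ (U.ncard : ℕ) := by
    calc ((H.oddComponents.ncard : ℕ) : ℝ)
        = ∑ C ∈ H.oddComponents.toFinset, (1 : ℝ) := by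
          rw [Finset.sum_const, Set.ncard_eq_toFinset_card']; simp
      _ ≤ ∑ C ∈ H.oddComponents.toFinset, cutSum a b y (S C) := by
          refine Finset.sum_le_sum fun C hC => h.odd _ ?_
          rw [cardS]
          simpa using hC
      _ ≤ ∑ C, cutSum a b y (S C) := by
          refine Finset.sum_le_sum_of_subset_of_nonneg (Finset.subset_univ _) fun C _ _ => ?_
          refine Finset.sum_nonneg fun e _ => ?_
          split_ifs
          exacts [h.nonneg e, le_rfl]
      _ ≤ ∑ u ∈ U.toFinset, cutSum a b y {u} := by
          simp only [cutSum]
          rw [Finset.sum_comm, Finset.sum_comm (s := U.toFinset)]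
          exact Finset.sum_le_sum fun e _ => key e
      _ = (U.ncard : ℕ) := by
          simp only [h.deg, Finset.sum_const, Set.ncard_eq_toFinset_card']; simp
  exact_mod_cast h1

/-- The support of a vector in Edmonds' polytope contains a perfect matching. -/
lemma InPolytope.exists_matching_support {a b : E → V} {y : E → ℝ} (h : InPolytope a b y) :
    ∃ N, IsMatchingOf a b N ∧ ∀ e ∈ N, 0 < y e := by
  obtain ⟨M, hM⟩ := SimpleGraph.tutte.2 h.not_isTutteViolator
  rw [SimpleGraph.Subgraph.isPerfectMatching_iff] at hM
  have hex : ∀ z : M.edgeSet, ∃ e, 0 < y e ∧ s(a e, b e) = z := by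
    rintro ⟨z, hz⟩
    induction z with
    | _ u v =>
      obtain ⟨-, e, he, hs⟩ := M.adj_sub hz
      exact ⟨e, he, hs⟩
  choose g hg using hex
  refine ⟨Finset.univ.image g, ⟨?_, fun v => ?_⟩, ?_⟩
  · intro e he
    obtain ⟨z, -, rfl⟩ := Finset.mem_image.1 he
    exact h.ne_of_pos (hg z).1
  · obtain ⟨u, hu, huniq⟩ := hM v
    refine ⟨g ⟨s(v, u), hu⟩, ⟨Finset.mem_image_of_mem _ (Finset.mem_univ _), ?_⟩, ?_⟩
    · rw [crosses_singleton (h.ne_of_pos (hg _).1)]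
      have := (hg ⟨s(v, u), hu⟩).2
      have hv : v ∈ s(a (g ⟨s(v, u), hu⟩), b (g ⟨s(v, u), hu⟩)) := by rw [this]; simp
      rw [Sym2.mem_iff] at hv
      exact hv.imp Eq.symm Eq.symm
    · rintro e ⟨he, hc⟩
      obtain ⟨⟨z, hz⟩, -, rfl⟩ := Finset.mem_image.1 he
      have h1 := (hg ⟨z, hz⟩).2
      rw [crosses_singleton (h.ne_of_pos (hg _).1)] at hc
      have hv : v ∈ z := by
        have hv : v ∈ s(a (g ⟨z, hz⟩), b (g ⟨z, hz⟩)) :=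
          Sym2.mem_iff.2 (hc.imp Eq.symm Eq.symm)
        rwa [h1] at hv
      obtain ⟨t, rfl⟩ := Sym2.mem_iff_exists.1 hv
      have := huniq t hz
      subst this
      rfl
  · intro e he
    obtain ⟨z, -, rfl⟩ := Finset.mem_image.1 he
    exact (hg z).1

end Multigraph

/-! ### The polytope theorem, by contracting tight odd cuts -/

section Multigraph

open scoped Classical

open Filter Topology

variable {V E : Type*}

/-- `N` is a perfect matching, supported on the positive edges of `y`, of the multigraph obtained
by contracting the complement of `S` to one vertex. -/
structure IsContractedMatching (a b : E → V) (S : Finset V) (y : E → ℝ) (N : Finset E) :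
    Prop where
  pos : ∀ e ∈ N, 0 < y e
  touches : ∀ e ∈ N, a e ∈ S ∨ b e ∈ S
  deg : ∀ v ∈ S, ∃! e, e ∈ N ∧ Crosses a b {v} e
  cut : ∃! e, e ∈ N ∧ Crosses a b S e

lemma sum_ite_crosses {a b : E → V} {S : Finset V} {N : Finset E} {e : E} (he : e ∈ N)
    (hc : Crosses a b S e) (hu : ∀ f ∈ N, Crosses a b S f → f = e) (g h : E → ℝ) :
    ∑ f ∈ N, (if Crosses a b S f then g f else h f) =
      g e + ∑ f ∈ N, if Crosses a b S f then 0 else h f := by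
  have h1 : ∑ f ∈ N, (if Crosses a b S f then g f else 0) = g e := by
    rw [Finset.sum_eq_single_of_mem e he, if_pos hc]
    exact fun f hf hne => if_neg fun hfc => hne (hu f hf hfc)
  rw [← h1, ← Finset.sum_add_distrib]
  refine Finset.sum_congr rfl fun f _ => ?_
  split_ifs <;> simp

/-- The map contracting the complement of `S` to one vertex. -/
noncomputable def contract (S : Finset V) (v : V) : Option S :=
  if h : v ∈ S then some ⟨v, h⟩ else none

lemma contract_eq_some {S : Finset V} {v : V} {u : S} : contract S v = some u ↔ v = u := by
  unfold contract
  split_ifs with h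
  · simp [Subtype.ext_iff]
  · simp only [false_iff]
    rintro rfl
    exact h u.2

lemma contract_eq_none {S : Finset V} {v : V} : contract S v = none ↔ v ∉ S := by
  unfold contract
  split_ifs with h <;> simp [h]

lemma continuous_cutSum [Fintype E] (a b : E → V) (S : Finset V) : Continuous fun y => cutSum a b y S := by
  unfold cutSum
  refine continuous_finsetSum _ fun e _ => ?_
  split_ifs <;> fun_prop

/-- Fixing the coordinates in `Z` at zero keeps a minimizer inside the support of a given point. -/
lemma isCompact_polytope_face [Fintype E] (a b : E → V) (Z : Set E) :
    IsCompact {x | InPolytope a b x ∧ ∀ e ∈ Z, x e = 0} := by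
  have hcl : IsClosed {x | InPolytope a b x ∧ ∀ e ∈ Z, x e = 0} := by
    have : {x | InPolytope a b x ∧ ∀ e ∈ Z, x e = 0} =
        (⋂ e, {x : E → ℝ | 0 ≤ x e}) ∩ (⋂ e, ⋂ (_ : a e = b e), {x : E → ℝ | x e = 0}) ∩
        (⋂ v, {x : E → ℝ | cutSum a b x {v} = 1}) ∩
        (⋂ S : Finset V, ⋂ (_ : Odd S.card), {x : E → ℝ | 1 ≤ cutSum a b x S}) ∩
        (⋂ e, ⋂ (_ : e ∈ Z), {x : E → ℝ | x e = 0}) := by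
      ext x
      simp only [Set.mem_ofPred_eq, Set.mem_inter_iff, Set.mem_iInter]
      exact ⟨fun ⟨h, h'⟩ => ⟨⟨⟨⟨h.nonneg, h.loop⟩, h.deg⟩, h.odd⟩, h'⟩,
        fun ⟨⟨⟨⟨p, q⟩, r⟩, s⟩, h'⟩ => ⟨⟨p, q, r, s⟩, h'⟩⟩
    rw [this]
    refine ((((isClosed_iInter fun e => ?_).inter (isClosed_iInter fun e => isClosed_iInter
      fun _ => ?_)).inter (isClosed_iInter fun v => ?_)).inter (isClosed_iInter fun S =>
      isClosed_iInter fun _ => ?_)).inter (isClosed_iInter fun e => isClosed_iInter fun _ => ?_)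
    · exact isClosed_le continuous_const (continuous_apply e)
    · exact isClosed_eq (continuous_apply e) continuous_const
    · exact isClosed_eq (continuous_cutSum a b {v}) continuous_const
    · exact isClosed_le continuous_const (continuous_cutSum a b S)
    · exact isClosed_eq (continuous_apply e) continuous_const
  refine (isCompact_univ_pi fun _ : E => isCompact_Icc (a := (0 : ℝ)) (b := 1)).of_isClosed_subset
    hcl fun x hx e _ => ⟨hx.1.nonneg e, hx.1.le_one e⟩

section

variable [Fintype V]

lemma crosses_contract {a b : E → V} {S : Finset V} {T : Finset (Option S)} {e : E} :
    Crosses (contract S ∘ a) (contract S ∘ b) T e ↔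
      Crosses a b (Finset.univ.filter fun v => contract S v ∈ T) e := by
  simp [Crosses]

lemma filter_contract_some {S : Finset V} (u : S) :
    (Finset.univ.filter fun v => contract S v ∈ ({some u} : Finset (Option S))) = {(u : V)} := by
  ext v
  simp [contract_eq_some]

lemma filter_contract_none {S : Finset V} :
    (Finset.univ.filter fun v => contract S v ∈ ({none} : Finset (Option S))) = Sᶜ := by
  ext v
  simp [contract_eq_none]

/-- The fibres of the contraction are singletons and `Sᶜ`, all odd, so preimages preserve odd
cardinality. -/
lemma odd_card_filter_contract {S : Finset V} (hS : Odd Sᶜ.card) {T : Finset (Option S)}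
    (hT : Odd T.card) : Odd (Finset.univ.filter fun v => contract S v ∈ T).card := by
  have hfib : ∀ t ∈ T, Odd ((Finset.univ.filter fun v => contract S v = t).card) := by
    rintro (_ | u) -
    · have := filter_contract_none (S := S)
      simp only [Finset.mem_singleton] at this
      rwa [this]
    · have := filter_contract_some u
      simp only [Finset.mem_singleton] at this
      rw [this]
      simp
  have hsum : (Finset.univ.filter fun v => contract S v ∈ T).card =
      ∑ t ∈ T, (Finset.univ.filter fun v => contract S v = t).card := by
    rw [Finset.card_eq_sum_card_fiberwise (f := contract S) (t := T) fun v hv => by simpa using hv]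
    refine Finset.sum_congr rfl fun t ht => ?_
    congr 1
    ext v
    simp only [Finset.mem_filter, Finset.mem_univ, true_and]
    exact ⟨fun h => h.2, fun h => ⟨h ▸ ht, h⟩⟩
  rw [hsum, Finset.odd_sum_iff_odd_card_odd, Finset.filter_true_of_mem hfib]
  exact hT

lemma IsMatchingOf.isContractedMatching {a b : E → V} {S : Finset V} {y : E → ℝ} {N : Finset E}
    (hN : IsMatchingOf (contract S ∘ a) (contract S ∘ b) N)
    (hpos : ∀ e ∈ N, 0 < if a e ∈ S ∨ b e ∈ S then y e else 0) :
    IsContractedMatching a b S y N where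
  pos e he := by
    have := hpos e he
    split_ifs at this
    exacts [this, absurd this (lt_irrefl _)]
  touches e he := by
    by_contra hc
    have := hpos e he
    rw [if_neg hc] at this
    exact lt_irrefl _ this
  deg v hv := by
    have := hN.deg (some ⟨v, hv⟩)
    simpa only [crosses_contract, filter_contract_some] using this
  cut := by
    have := hN.deg none
    simpa only [crosses_contract, filter_contract_none, crosses_compl] using this

variable [Fintype E]

/-- The edges whose value is reset to zero lie inside `Sᶜ`; contraction makes them loops, which
cross no cut. -/
lemma cutSum_contract {a b : E → V} {S : Finset V} {y : E → ℝ} (T : Finset (Option S)) :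
    cutSum (contract S ∘ a) (contract S ∘ b)
        (fun e => if a e ∈ S ∨ b e ∈ S then y e else 0) T =
      cutSum a b y (Finset.univ.filter fun v => contract S v ∈ T) := by
  refine Finset.sum_congr rfl fun e _ => ?_
  rw [crosses_contract]
  refine if_ctx_congr Iff.rfl (fun h1 => if_pos ?_) fun _ => rfl
  by_contra h2
  rw [not_or] at h2
  simp [Crosses, contract_eq_none.2 h2.1, contract_eq_none.2 h2.2] at h1

/-- Tightness of `S` is exactly the degree condition at the contracted vertex; odd sets pull back to
odd sets. -/
lemma InPolytope.contract {a b : E → V} {S : Finset V} {y : E → ℝ} (h : InPolytope a b y)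
    (hS : Odd Sᶜ.card) (ht : cutSum a b y S = 1) :
    InPolytope (contract S ∘ a) (SmallestPM.contract S ∘ b)
      (fun e => if a e ∈ S ∨ b e ∈ S then y e else 0) where
  nonneg e := by
    split_ifs
    exacts [h.nonneg e, le_rfl]
  loop e hab := by
    split_ifs with h1
    · refine h.loop e ?_
      simp only [Function.comp_apply] at hab
      rcases h1 with h1 | h1
      · exact (contract_eq_some (u := ⟨a e, h1⟩).1
          (hab ▸ contract_eq_some (u := ⟨a e, h1⟩).2 rfl)).symm
      · exact contract_eq_some (u := ⟨b e, h1⟩).1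
          (hab.symm ▸ contract_eq_some (u := ⟨b e, h1⟩).2 rfl)
    · rfl
  deg := by
    rintro (_ | u)
    · rw [cutSum_contract, filter_contract_none, cutSum_compl, ht]
    · rw [cutSum_contract, filter_contract_some, h.deg]
  odd T hT := by
    rw [cutSum_contract]
    exact h.odd _ (odd_card_filter_contract hS hT)

/-- An edge of `K` that meets `S` must cross the cut, hence is the shared edge `e`, already in `N`.
So vertices of `S` see only `N`, and by symmetry vertices of `Sᶜ` see only `K`. -/
lemma IsContractedMatching.union {a b : E → V} {S : Finset V} {y : E → ℝ} {N K : Finset E}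
    {e : E} (hy : InPolytope a b y)
    (hN : IsContractedMatching a b S y N) (hK : IsContractedMatching a b Sᶜ y K)
    (heN : e ∈ N) (heK : e ∈ K) (he : Crosses a b S e) : IsMatchingOf a b (N ∪ K) := by
  have hpos : ∀ f ∈ N ∪ K, 0 < y f := fun f hf =>
    (Finset.mem_union.1 hf).elim (hN.pos f) (hK.pos f)
  have huN : ∀ f ∈ N, Crosses a b S f → f = e := fun f hf hfc =>
    hN.cut.unique ⟨hf, hfc⟩ ⟨heN, he⟩
  have huK : ∀ f ∈ K, Crosses a b S f → f = e := fun f hf hfc =>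
    hK.cut.unique ⟨hf, crosses_compl.2 hfc⟩ ⟨heK, crosses_compl.2 he⟩
  refine ⟨fun f hf => hy.ne_of_pos (hpos f hf), fun v => ?_⟩
  by_cases hv : v ∈ S
  · obtain ⟨f, ⟨hf, hfc⟩, hu⟩ := hN.deg v hv
    refine ⟨f, ⟨Finset.mem_union_left _ hf, hfc⟩, ?_⟩
    rintro g ⟨hg, hgc⟩
    rcases Finset.mem_union.1 hg with hg' | hg'
    · exact hu g ⟨hg', hgc⟩
    · have hcr : Crosses a b S g := by
        have h1 := hK.touches g hg'
        rw [crosses_singleton (hy.ne_of_pos (hpos g hg))] at hgc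
        simp only [Finset.mem_compl] at h1
        rw [Crosses]
        rcases hgc with rfl | rfl <;> tauto
      exact hu g ⟨huK g hg' hcr ▸ heN, hgc⟩
  · obtain ⟨f, ⟨hf, hfc⟩, hu⟩ := hK.deg v (Finset.mem_compl.2 hv)
    refine ⟨f, ⟨Finset.mem_union_right _ hf, hfc⟩, ?_⟩
    rintro g ⟨hg, hgc⟩
    rcases Finset.mem_union.1 hg with hg' | hg'
    · have hcr : Crosses a b S g := by
        have h1 := hN.touches g hg'
        rw [crosses_singleton (hy.ne_of_pos (hpos g hg))] at hgc
        rw [Crosses]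
        rcases hgc with rfl | rfl <;> tauto
      exact hu g ⟨huN g hg' hcr ▸ heK, hgc⟩
    · exact hu g ⟨hg', hgc⟩

/-- Let `c e` be the cheapest completion on the `Sᶜ` side through a cut edge `e`, not counting `e`
itself. Charge `w + c` on the cut on the `S` side and `-c` on the `Sᶜ` side. The second problem has
nonnegative value, so a good solution of the first, glued to its cheapest completion, costs at most
the combined total `w · y`. -/
lemma exists_matching_le_of_contracted {a b : E → V} {S : Finset V} {y : E → ℝ}
    (hy : InPolytope a b y)
    (h1 : ∀ w : E → ℝ, ∃ N, IsContractedMatching a b S y N ∧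
      ∑ e ∈ N, w e ≤ ∑ e, w e * if a e ∈ S ∨ b e ∈ S then y e else 0)
    (h2 : ∀ w : E → ℝ, ∃ N, IsContractedMatching a b Sᶜ y N ∧
      ∑ e ∈ N, w e ≤ ∑ e, w e * if a e ∈ Sᶜ ∨ b e ∈ Sᶜ then y e else 0) (w : E → ℝ) :
    ∃ N, IsMatchingOf a b N ∧ (∀ e ∈ N, 0 < y e) ∧ ∑ e ∈ N, w e ≤ ∑ e, w e * y e := by
  let wi : E → ℝ := fun f => if Crosses a b S f then 0 else w f
  have hex : ∀ e, ∃ K, Crosses a b S e → 0 < y e → (IsContractedMatching a b Sᶜ y K ∧ e ∈ K) ∧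
      ∀ K', IsContractedMatching a b Sᶜ y K' → e ∈ K' → ∑ f ∈ K, wi f ≤ ∑ f ∈ K', wi f := by
    intro e
    by_cases he : Crosses a b S e ∧ 0 < y e
    -- With cost `-1` on `e` alone the bound is `-y e < 0`, which forces a contracted matching
    -- through `e`.
    · obtain ⟨K, hK, hKe⟩ := h2 (fun f => if f = e then -1 else 0)
      have hmem : e ∈ K := by
        by_contra hne
        have ht : a e ∈ Sᶜ ∨ b e ∈ Sᶜ := by
          have := he.1
          simp only [Crosses, Finset.mem_compl] at this ⊢
          tauto
        have hl : ∑ f ∈ K, (if f = e then (-1 : ℝ) else 0) = 0 := by simp [hne]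
        rw [hl, Finset.sum_eq_single_of_mem e (Finset.mem_univ e)
          fun f _ hf => by rw [if_neg hf, zero_mul], if_pos rfl, if_pos ht] at hKe
        linarith [he.2]
      obtain ⟨K', hK', hmin⟩ := Finset.exists_min_image
        (Finset.univ.filter fun K => IsContractedMatching a b Sᶜ y K ∧ e ∈ K)
        (fun K => ∑ f ∈ K, wi f) ⟨K, by simp [hK, hmem]⟩
      refine ⟨K', fun _ _ => ⟨by simpa using hK', fun L hL heL => hmin L (by simp [hL, heL])⟩⟩
    · exact ⟨∅, fun h h' => absurd ⟨h, h'⟩ he⟩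
  choose K hK using hex
  let c : E → ℝ := fun e => ∑ f ∈ K e, wi f
  obtain ⟨L, hL, hLle⟩ := h2 fun f => if Crosses a b S f then - c f else w f
  -- The edges of `L` off the cut form one completion of its cut edge, so they cost at least `c`.
  have hL0 : 0 ≤ ∑ f ∈ L, if Crosses a b S f then - c f else w f := by
    obtain ⟨e, ⟨heL, hec⟩, hu⟩ := hL.cut
    rw [sum_ite_crosses heL (crosses_compl.1 hec)
      (fun f hf hfc => hu f ⟨hf, crosses_compl.2 hfc⟩)]
    have := (hK e (crosses_compl.1 hec) (hL.pos e heL)).2 L hL heL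
    simp only [wi, c] at this ⊢
    linarith
  obtain ⟨N, hN, hNle⟩ := h1 fun f => if Crosses a b S f then w f + c f else w f
  obtain ⟨e, ⟨heN, hec⟩, hu⟩ := hN.cut
  obtain ⟨⟨hKm, heK⟩, -⟩ := hK e hec (hN.pos e heN)
  have huK : ∀ f ∈ K e, Crosses a b S f → f = e := fun f hf hfc =>
    hKm.cut.unique ⟨hf, crosses_compl.2 hfc⟩ ⟨heK, crosses_compl.2 hec⟩
  refine ⟨N ∪ K e, hN.union hy hKm heN heK hec, fun f hf =>
    (Finset.mem_union.1 hf).elim (hN.pos f) (hKm.pos f), ?_⟩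
  -- An edge in both `N` and `K e` touches both sides, so it crosses the cut; conversely the only
  -- crossing edge of `K e` is `e`, which lies in `N`.
  have hsumK : ∑ f ∈ K e \ N, w f = c e := by
    rw [← Finset.filter_notMem_eq_sdiff, Finset.sum_filter]
    refine Finset.sum_congr rfl fun f hf => ?_
    by_cases hfN : f ∈ N
    · have : Crosses a b S f := by
        have t1 := hN.touches f hfN
        have t2 := hKm.touches f hf
        simp only [Finset.mem_compl] at t2
        rw [Crosses]; tauto
      simp [wi, hfN, this]
    · have : ¬ Crosses a b S f := fun hfc => hfN (huK f hf hfc ▸ heN)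
      simp [wi, hfN, this]
  have hsum : ∑ f ∈ N ∪ K e, w f =
      ∑ f ∈ N, if Crosses a b S f then w f + c f else w f := by
    rw [← Finset.union_sdiff_self_eq_union, Finset.sum_union Finset.disjoint_sdiff, hsumK,
      sum_ite_crosses heN hec (fun f hf hfc => hu f ⟨hf, hfc⟩), add_right_comm,
      ← sum_ite_crosses heN hec (fun f hf hfc => hu f ⟨hf, hfc⟩) w w]
    simp
  -- Edges inside one side occur in one sum only; on the cut the charges `c` and `-c` cancel.
  have htot : (∑ f, (if Crosses a b S f then w f + c f else w f) *
        if a f ∈ S ∨ b f ∈ S then y f else 0) +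
      (∑ f, (if Crosses a b S f then - c f else w f) *
        if a f ∈ Sᶜ ∨ b f ∈ Sᶜ then y f else 0) = ∑ f, w f * y f := by
    rw [← Finset.sum_add_distrib]
    refine Finset.sum_congr rfl fun f _ => ?_
    by_cases ha : a f ∈ S <;> by_cases hb : b f ∈ S <;> simp [Crosses, ha, hb] <;> ring
  linarith

/-- The strict inequalities are finitely many and survive small `s`. Off `N` moving away from `N`
cannot decrease a coordinate, and cuts tight for both points keep the value `1`. -/
lemma InPolytope.exists_perturbation {a b : E → V} {x : E → ℝ} {N : Finset E}
    (hx : InPolytope a b x) (hN : IsMatchingOf a b N) (hpos : ∀ e ∈ N, 0 < x e)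
    (ht : ∀ S : Finset V, Odd S.card → cutSum a b x S = 1 → cutSum a b (charVec N) S = 1) :
    ∃ s : ℝ, 0 < s ∧ InPolytope a b fun e => x e + s * (x e - charVec N e) := by
  have hcont : ∀ p q : ℝ, 0 < p → ∀ᶠ s in 𝓝[>] (0 : ℝ), 0 < p + s * q := by
    intro p q hp
    refine nhdsWithin_le_nhds ?_
    have : ContinuousAt (fun s : ℝ => p + s * q) 0 := by fun_prop
    refine this.eventually (lt_mem_nhds ?_)
    simpa using hp
  have h0 : ∀ᶠ s in 𝓝[>] (0 : ℝ), 0 < s := eventually_mem_nhdsWithin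
  have h1 : ∀ᶠ s in 𝓝[>] (0 : ℝ), ∀ e, 0 ≤ x e + s * (x e - charVec N e) := by
    rw [eventually_all]
    intro e
    by_cases he : e ∈ N
    · exact (hcont _ _ (hpos e he)).mono fun s hs => hs.le
    · filter_upwards [h0] with s hs
      rw [charVec_of_notMem he]
      have := hx.nonneg e
      positivity
  have h2 : ∀ᶠ s in 𝓝[>] (0 : ℝ), ∀ S : Finset V, Odd S.card →
      1 ≤ cutSum a b (fun e => x e + s * (x e - charVec N e)) S := by
    rw [eventually_all]
    intro S
    by_cases hS : Odd S.card
    · rcases (hx.odd S hS).eq_or_lt with h | h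
      · filter_upwards with s _
        rw [cutSum_combo, ht S hS h.symm, ← h]
        simp
      · filter_upwards [hcont (cutSum a b x S - 1) (cutSum a b x S - cutSum a b (charVec N) S)
          (by linarith)] with s hs _
        rw [cutSum_combo]
        linarith
    · exact Eventually.of_forall fun s h => absurd h hS
  obtain ⟨s, hs0, hs1, hs2⟩ := (h0.and (h1.and h2)).exists
  refine ⟨s, hs0, hs1, fun e hab => ?_, fun v => ?_, hs2⟩
  · rw [hx.loop e hab, charVec_of_notMem fun he => hN.loop e he hab]
    simp
  · rw [cutSum_combo, hx.deg, cutSum_eq_one_of_existsUnique (hN.deg v)]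
    simp

end

/-- **Edmonds' perfect matching polytope theorem**: a linear functional on the polytope is at
least its value at some perfect matching in the support of the given point. -/
theorem InPolytope.exists_matching_le {V E : Type*} [Fintype V] [Fintype E] {a b : E → V}
    {y : E → ℝ} (hy : InPolytope a b y) (w : E → ℝ) :
    ∃ N, IsMatchingOf a b N ∧ (∀ e ∈ N, 0 < y e) ∧ ∑ e ∈ N, w e ≤ ∑ e, w e * y e := by
  induction hn : Fintype.card V using Nat.strong_induction_on generalizing V y w with
  | _ n ih =>
  subst hn
  obtain ⟨x, ⟨hx, hxZ⟩, hxmin⟩ := (isCompact_polytope_face a b {e | y e = 0}).exists_isMinOn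
    ⟨y, hy, fun e he => he⟩
    (f := fun x => ∑ e, w e * x e) (by fun_prop)
  have hxy : ∑ e, w e * x e ≤ ∑ e, w e * y e := hxmin ⟨hy, fun e he => he⟩
  have hsupp : ∀ e, 0 < x e → 0 < y e := fun e he =>
    (hy.nonneg e).lt_of_ne fun h => he.ne' (hxZ e h.symm)
  obtain ⟨N₀, hN₀, hN₀x⟩ := hx.exists_matching_support
  by_cases htight : ∀ S : Finset V, Odd S.card → cutSum a b x S = 1 →
      cutSum a b (charVec N₀) S = 1
  · obtain ⟨s, hs, hxs⟩ := hx.exists_perturbation hN₀ hN₀x htight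
    refine ⟨N₀, hN₀, fun e he => hsupp e (hN₀x e he), le_trans ?_ hxy⟩
    -- The perturbed point lies in the same face, so optimality of `x` makes the direction `x -
    -- χ_N₀` non-decreasing for `w`.
    have hle : ∑ e, w e * x e ≤ ∑ e, w e * (x e + s * (x e - charVec N₀ e)) := by
      refine hxmin ⟨hxs, fun e he => ?_⟩
      have hxe := hxZ e he
      have : e ∉ N₀ := fun h => (hN₀x e h).ne' hxe
      simp [hxe, charVec_of_notMem this]
    rw [sum_mul_combo] at hle
    have := nonneg_of_mul_nonneg_right (le_of_add_le_add_left ((add_zero _).trans_le hle)) hs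
    linarith
  · push Not at htight
    obtain ⟨S, hS, hSx, hSN⟩ := htight
    have hcard : S.card + Sᶜ.card = Fintype.card V := Finset.card_add_card_compl S
    have hSc : Odd Sᶜ.card := by
      have := hx.even_card
      rw [← hcard] at this
      exact (Nat.even_add'.1 this).1 hS
    -- Singleton cuts are tight for `N₀`, so the violated cut has at least two vertices on each side
    -- and both contractions are strictly smaller.
    have hne1 : ∀ T : Finset V, cutSum a b (charVec N₀) T ≠ 1 → Odd T.card → 2 ≤ T.card := by
      intro T hT hodd
      have h1 : T.card ≠ 1 := fun h => by
        obtain ⟨v, rfl⟩ := Finset.card_eq_one.1 h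
        exact hT (cutSum_eq_one_of_existsUnique (hN₀.deg v))
      have := hodd.pos
      omega
    have hS2 := hne1 S hSN hS
    have hSc2 := hne1 Sᶜ (by rwa [cutSum_compl]) hSc
    have hhalf : ∀ T : Finset V, cutSum a b x T = 1 → Odd Tᶜ.card → 2 ≤ Tᶜ.card →
        ∀ w : E → ℝ, ∃ N, IsContractedMatching a b T x N ∧
          ∑ e ∈ N, w e ≤ ∑ e, w e * if a e ∈ T ∨ b e ∈ T then x e else 0 := by
      intro T hT hodd h2 w'
      have hlt : Fintype.card (Option T) < Fintype.card V := by
        have : T.card + Tᶜ.card = Fintype.card V := Finset.card_add_card_compl T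
        simp only [Fintype.card_option, Fintype.card_coe]
        omega
      obtain ⟨N, hN, hpos, hle⟩ := ih _ hlt (hx.contract hodd hT) w' rfl
      exact ⟨N, hN.isContractedMatching hpos, hle⟩
    obtain ⟨N, hN, hpos, hle⟩ := exists_matching_le_of_contracted hx (hhalf S hSx hSc hSc2)
      (hhalf Sᶜ (by rwa [cutSum_compl]) (by rwa [compl_compl]) (by rwa [compl_compl])) w
    exact ⟨N, hN, fun e he => hsupp e (hpos e he), hle.trans hxy⟩

end Multigraph

/-! ### Pairs of matching edges and tight cuts -/

section Multigraph

open scoped Classical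

variable {V E : Type*}

/-- A matching edge that does not cross `S` covers zero or two of its vertices, so if none crossed,
`S` would be even. -/
lemma IsMatchingOf.exists_crosses {a b : E → V} {N : Finset E} (hN : IsMatchingOf a b N)
    {S : Finset V} (hS : Odd S.card) : ∃ e ∈ N, Crosses a b S e := by
  by_contra! hno
  have h1 : S.card = ∑ e ∈ N, ∑ v ∈ S, if Crosses a b {v} e then 1 else 0 := by
    rw [Finset.sum_comm, Finset.card_eq_sum_ones]
    refine Finset.sum_congr rfl fun v _ => ?_
    obtain ⟨e, ⟨he, hc⟩, hu⟩ := hN.deg v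
    rw [Finset.sum_eq_single_of_mem e he, if_pos hc]
    exact fun f hf hne => if_neg fun hfc => hne (hu f ⟨hf, hfc⟩)
  have h2 : Even S.card := by
    rw [h1]
    refine Finset.even_sum _ fun e he => ?_
    have hab := hN.loop e he
    have hse : a e ∈ S ↔ b e ∈ S := not_not.1 (hno e he)
    simp only [crosses_singleton hab]
    rw [← Finset.card_filter]
    by_cases ha : a e ∈ S
    · have : (S.filter fun v => a e = v ∨ b e = v) = {a e, b e} := by
        ext v
        simp only [Finset.mem_filter, Finset.mem_insert, Finset.mem_singleton]
        constructor
        · rintro ⟨-, h | h⟩ <;> simp [h]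
        · rintro (rfl | rfl)
          exacts [⟨ha, Or.inl rfl⟩, ⟨hse.1 ha, Or.inr rfl⟩]
      rw [this, Finset.card_pair hab]
      exact even_two
    · rw [Finset.filter_false_of_mem]
      · simp
      · rintro v hv (rfl | rfl)
        exacts [ha hv, ha (hse.2 hv)]
  exact Nat.not_even_iff_odd.2 hS h2

variable [Fintype E]

lemma add_le_cutSum {a b : E → V} {y : E → ℝ} (hy : ∀ e, 0 ≤ y e) {S : Finset V} {e f : E}
    (he : Crosses a b S e) (hf : Crosses a b S f) (hne : e ≠ f) :
    y e + y f ≤ cutSum a b y S := by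
  have := Finset.sum_le_sum_of_subset_of_nonneg (Finset.subset_univ {e, f})
    (f := fun f => if Crosses a b S f then y f else 0)
    (fun f _ _ => by split_ifs; exacts [hy f, le_rfl])
  rw [Finset.sum_pair hne] at this
  simpa [cutSum, he, hf] using this

lemma IsMatchingOf.inPolytope {a b : E → V} {N : Finset E} (hN : IsMatchingOf a b N) :
    InPolytope a b (charVec N) where
  nonneg := charVec_nonneg N
  loop e hab := charVec_of_notMem fun he => hN.loop e he hab
  deg v := cutSum_eq_one_of_existsUnique (hN.deg v)
  odd S hS := by
    obtain ⟨e, he, hc⟩ := hN.exists_crosses hS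
    rw [← charVec_of_mem he]
    exact le_cutSum (charVec_nonneg N) hc

lemma cutSum_average {ι : Type*} (a b : E → V) (P : Finset ι) (z : ι → E → ℝ) (S : Finset V) :
    cutSum a b (fun e => (P.card : ℝ)⁻¹ * ∑ p ∈ P, z p e) S =
      (P.card : ℝ)⁻¹ * ∑ p ∈ P, cutSum a b (z p) S := by
  simp only [cutSum]
  rw [Finset.sum_comm, Finset.mul_sum]
  refine Finset.sum_congr rfl fun e _ => ?_
  split_ifs <;> simp

lemma InPolytope.average {ι : Type*} {a b : E → V} {P : Finset ι} (hP : P.Nonempty)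
    {z : ι → E → ℝ} (hz : ∀ p ∈ P, InPolytope a b (z p)) :
    InPolytope a b fun e => (P.card : ℝ)⁻¹ * ∑ p ∈ P, z p e := by
  have hpos : (0 : ℝ) < P.card := by exact_mod_cast hP.card_pos
  refine ⟨fun e => ?_, fun e hab => ?_, fun v => ?_, fun S hS => ?_⟩
  · exact mul_nonneg (inv_nonneg.2 hpos.le) (Finset.sum_nonneg fun p hp => (hz p hp).nonneg e)
  · rw [Finset.sum_eq_zero fun p hp => (hz p hp).loop e hab, mul_zero]
  · rw [cutSum_average, Finset.sum_congr rfl fun p hp => (hz p hp).deg v]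
    simp [hpos.ne']
  · rw [cutSum_average, le_inv_mul_iff₀ hpos, mul_one]
    have := Finset.sum_le_sum fun p hp => (hz p hp).odd S hS
    simpa using this

/-- An edge of value `1` uses up the degree of its ends, leaving no positive value for another edge
of `N` there. -/
lemma InPolytope.mem_of_eq_one {a b : E → V} {y : E → ℝ} (hy : InPolytope a b y) {N : Finset E}
    (hN : IsMatchingOf a b N) (hpos : ∀ e ∈ N, 0 < y e) {e : E} (he : y e = 1) : e ∈ N := by
  obtain ⟨f, ⟨hf, hfc⟩, -⟩ := hN.deg (a e)
  by_contra hne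
  have hec : Crosses a b {a e} e :=
    (crosses_singleton (hy.ne_of_pos (he ▸ one_pos))).2 (Or.inl rfl)
  have := add_le_cutSum hy.nonneg hec hfc fun h => hne (h ▸ hf)
  rw [hy.deg, he] at this
  linarith [hpos f hf]

/-- If all pairs of edges of a perfect matching `M ⊇ F` extend to perfect matchings that have
minimum weight among those containing `F`, then so has `M`. -/
theorem IsMatchingOf.sum_le_of_pairs [Fintype V] {a b : E → V} {M F : Finset E}
    (hM : IsMatchingOf a b M) (hne : M.Nonempty) (hF : F ⊆ M) {w : E → ℝ} {α : ℝ}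
    (hmin : ∀ N, IsMatchingOf a b N → F ⊆ N → α ≤ ∑ e ∈ N, w e)
    (hpair : ∀ e ∈ M, ∀ f ∈ M, ∃ N, IsMatchingOf a b N ∧ F ⊆ N ∧ e ∈ N ∧ f ∈ N ∧
      ∑ e ∈ N, w e ≤ α) : ∑ e ∈ M, w e ≤ α := by
  have hex : ∀ p : E × E, ∃ N, p ∈ M ×ˢ M → IsMatchingOf a b N ∧ F ⊆ N ∧ p.1 ∈ N ∧ p.2 ∈ N ∧
      ∑ e ∈ N, w e ≤ α := by
    intro p
    by_cases hp : p ∈ M ×ˢ M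
    · obtain ⟨N, hN⟩ := hpair p.1 (Finset.mem_product.1 hp).1 p.2 (Finset.mem_product.1 hp).2
      exact ⟨N, fun _ => hN⟩
    · exact ⟨∅, fun h => absurd h hp⟩
  choose K hK using hex
  set P := M ×ˢ M
  have hPne : P.Nonempty := hne.product hne
  have hPpos : (0 : ℝ) < P.card := by exact_mod_cast hPne.card_pos
  set x : E → ℝ := fun e => (P.card : ℝ)⁻¹ * ∑ p ∈ P, charVec (K p) e with hxdef
  have hx : InPolytope a b x := InPolytope.average hPne fun p hp => (hK p hp).1.inPolytope
  have hxpos : ∀ e ∈ M, 0 < x e := by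
    intro e he
    have hp : (e, e) ∈ P := Finset.mk_mem_product he he
    refine mul_pos (inv_pos.2 hPpos) (Finset.sum_pos' (fun p _ => charVec_nonneg _ _)
      ⟨(e, e), hp, ?_⟩)
    rw [charVec_of_mem (hK _ hp).2.2.1]
    exact one_pos
  have hxF : ∀ e ∈ F, x e = 1 := by
    intro e he
    rw [hxdef]
    dsimp only
    rw [Finset.sum_congr rfl fun p hp => charVec_of_mem ((hK p hp).2.1 he)]
    simp [hPpos.ne']
  have hxw : ∑ e, w e * x e ≤ α := by
    have h1 : ∑ e, w e * x e = (P.card : ℝ)⁻¹ * ∑ p ∈ P, ∑ e ∈ K p, w e := by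
      rw [Finset.sum_congr rfl fun p _ => (sum_mul_charVec w (K p)).symm, Finset.sum_comm,
        Finset.mul_sum]
      refine Finset.sum_congr rfl fun e _ => ?_
      rw [← Finset.mul_sum]
      ring
    rw [h1, inv_mul_le_iff₀ hPpos]
    have := Finset.sum_le_sum fun p hp => (hK p hp).2.2.2.2
    simpa using this
  have htight : ∀ S : Finset V, Odd S.card → cutSum a b x S = 1 →
      cutSum a b (charVec M) S = 1 := by
    intro S hS h1
    have hge : ∀ p ∈ P, 1 ≤ cutSum a b (charVec (K p)) S := fun p hp =>
      (hK p hp).1.inPolytope.odd S hS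
    -- An average of numbers at least `1` equals `1` only if all of them do.
    have hall : ∀ p ∈ P, 1 = cutSum a b (charVec (K p)) S := by
      rw [← Finset.sum_eq_sum_iff_of_le hge]
      rw [hxdef, cutSum_average, inv_mul_eq_one₀ hPpos.ne'] at h1
      simpa using h1
    obtain ⟨e, he, hec⟩ := hM.exists_crosses hS
    refine cutSum_eq_one_of_existsUnique ⟨e, ⟨he, hec⟩, fun f hf => ?_⟩
    by_contra hfe
    -- The matching chosen for this pair would cross the tight cut twice.
    have hp : (f, e) ∈ P := Finset.mk_mem_product hf.1 he
    have := add_le_cutSum (charVec_nonneg (K (f, e))) hf.2 hec hfe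
    rw [← hall _ hp, charVec_of_mem (hK _ hp).2.2.1, charVec_of_mem (hK _ hp).2.2.2.1] at this
    norm_num at this
  obtain ⟨s, hs, hy⟩ := hx.exists_perturbation hM hxpos htight
  obtain ⟨N, hN, hNpos, hNle⟩ := hy.exists_matching_le w
  rw [sum_mul_combo] at hNle
  have hFN : F ⊆ N := fun e he => hy.mem_of_eq_one hN hNpos <| by
    simp [hxF e he, charVec_of_mem (hF he)]
  have h1 := hmin N hN hFN
  by_contra! hlt
  have : s * (∑ e, w e * x e - ∑ e ∈ M, w e) < 0 := mul_neg_of_pos_of_neg hs (by linarith)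
  linarith

end Multigraph

/-! ### Ranks of weights, the greedy choice and the enumeration -/

section Graph

variable {V : Type*} {G : SimpleGraph V}

lemma exists_ends (G : SimpleGraph V) :
    ∃ a b : G.edgeSet → V, ∀ e : G.edgeSet, (e : Sym2 V) = s(a e, b e) := by
  have h : ∀ e : G.edgeSet, ∃ p : V × V, (e : Sym2 V) = s(p.1, p.2) := by
    rintro ⟨e, -⟩
    induction e with
    | _ u v => exact ⟨(u, v), rfl⟩
  choose p hp using h
  exact ⟨fun e => (p e).1, fun e => (p e).2, hp⟩

lemma isMatchingOf_iff {a b : G.edgeSet → V} (hab : ∀ e : G.edgeSet, (e : Sym2 V) = s(a e, b e))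
    {M : Finset G.edgeSet} : IsMatchingOf a b M ↔ IsPerfectMatching M := by
  have hne : ∀ e, a e ≠ b e := by
    intro e
    have h := e.2
    rw [hab e, SimpleGraph.mem_edgeSet] at h
    exact h.ne
  have hc : ∀ v e, Crosses a b {v} e ↔ v ∈ (e : Sym2 V) := by
    intro v e
    rw [crosses_singleton (hne e), hab e, Sym2.mem_iff, eq_comm, @eq_comm _ v]
    simp [eq_comm]
  constructor
  · intro h v
    simpa only [hc] using h.deg v
  · exact fun h => ⟨fun e _ => hne e, fun v => by simpa only [hc] using h v⟩

/-- Some two edges of a perfect matching `M ⊇ F` lie together in no minimum-weight perfect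
matching containing `F`, unless `M` itself is one. -/
theorem exists_pair_weight_lt [Finite V] {w : G.edgeSet → ℤ} {F M N₁ : Finset G.edgeSet}
    (hM : IsPerfectMatching M) (hFM : F ⊆ M)
    (hmin : ∀ N, IsPerfectMatching N → F ⊆ N → weight w N₁ ≤ weight w N)
    (hlt : weight w N₁ < weight w M) :
    ∃ e ∈ M, ∃ f ∈ M, ∀ N, IsPerfectMatching N → F ⊆ N → e ∈ N → f ∈ N →
      weight w N₁ < weight w N := by
  have := Fintype.ofFinite V
  have := Fintype.ofFinite G.edgeSet
  obtain ⟨a, b, hab⟩ := exists_ends G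
  have hcast : ∀ N : Finset G.edgeSet, ((weight w N : ℤ) : ℝ) = ∑ e ∈ N, (w e : ℝ) := by
    simp [weight]
  -- The average over `M ×ˢ M` needs a nonempty `M`. An empty `M` leaves no vertices, hence no
  -- edges, so `N₁` would be empty too.
  have hne : M.Nonempty := by
    rw [Finset.nonempty_iff_ne_empty]
    rintro rfl
    have : N₁ = ∅ := Finset.eq_empty_of_forall_notMem fun e _ => by
      obtain ⟨f, ⟨hf, -⟩, -⟩ := hM (a e)
      simp at hf
    rw [this] at hlt
    exact lt_irrefl _ hlt
  by_contra! hno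
  refine absurd ?_ hlt.not_ge
  have := ((isMatchingOf_iff hab).2 hM).sum_le_of_pairs hne hFM (w := fun e => (w e : ℝ))
    (α := (weight w N₁ : ℤ)) (fun N hN hFN => ?_) fun e he f hf => ?_
  · rw [← hcast] at this
    exact_mod_cast this
  · rw [← hcast]
    exact_mod_cast hmin N ((isMatchingOf_iff hab).1 hN) hFN
  · obtain ⟨N, hN, hFN, heN, hfN, hle⟩ := hno e he f hf
    refine ⟨N, (isMatchingOf_iff hab).2 hN, hFN, heN, hfN, ?_⟩
    rw [← hcast]
    exact_mod_cast hle

/-- The weights of the perfect matchings. -/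
def matchingWeights (w : G.edgeSet → ℤ) : Set ℤ := {k | ∃ M, IsPerfectMatching M ∧ weight w M = k}

/-- The number of weights of perfect matchings below `k`. -/
noncomputable def rank (w : G.edgeSet → ℤ) (k : ℤ) : ℕ := {c ∈ matchingWeights w | c < k}.ncard

lemma minWeights_subset (w : G.edgeSet → ℤ) (s : ℕ) : minWeights w s ⊆ matchingWeights w := by
  rintro k ⟨F, -, ⟨M, hM, -, hk⟩, -⟩
  exact ⟨M, hM, hk⟩

variable [Finite V]

lemma matchingWeights_finite (w : G.edgeSet → ℤ) : (matchingWeights w).Finite := by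
  refine (Set.finite_range (weight w)).subset ?_
  rintro k ⟨M, -, hM⟩
  exact ⟨M, hM⟩

lemma matchingWeights_lt_finite (w : G.edgeSet → ℤ) (k : ℤ) :
    {c ∈ matchingWeights w | c < k}.Finite :=
  (matchingWeights_finite w).subset fun _ h => h.1

lemma rank_mono (w : G.edgeSet → ℤ) {k l : ℤ} (h : k ≤ l) : rank w k ≤ rank w l :=
  Set.ncard_le_ncard (fun _ hc => ⟨hc.1, hc.2.trans_le h⟩) (matchingWeights_lt_finite w l)

lemma rank_lt {w : G.edgeSet → ℤ} {k l : ℤ} (hk : k ∈ matchingWeights w) (h : k < l) :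
    rank w k < rank w l :=
  Set.ncard_lt_ncard ⟨fun _ hc => ⟨hc.1, hc.2.trans h⟩, fun hs => lt_irrefl k (hs ⟨hk, h⟩).2⟩
    (matchingWeights_lt_finite w l)

lemma exists_rank_eq_add_one {w : G.edgeSet → ℤ} {k : ℤ} (h : 0 < rank w k) :
    ∃ l ∈ matchingWeights w, l < k ∧ rank w k = rank w l + 1 := by
  obtain ⟨l, ⟨hl, hlk⟩, hmax⟩ := Set.exists_max_image _ id (matchingWeights_lt_finite w k)
    ((Set.ncard_pos (matchingWeights_lt_finite w k)).1 h)
  refine ⟨l, hl, hlk, ?_⟩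
  have : {c ∈ matchingWeights w | c < k} = insert l {c ∈ matchingWeights w | c < l} := by
    ext c
    constructor
    · intro hc
      rcases (show c ≤ l from hmax c hc).eq_or_lt with h | h
      exacts [Or.inl h, Or.inr ⟨hc.1, h⟩]
    · rintro (rfl | hc)
      exacts [⟨hl, hlk⟩, ⟨hc.1, hc.2.trans hlk⟩]
  rw [rank, this, Set.ncard_insert_of_notMem (fun h' => lt_irrefl _ h'.2)
    (matchingWeights_lt_finite w l), rank]

/-- Passing to the next smaller weight lowers the rank by exactly one, so no rank is skipped. -/
lemma exists_rank_eq {w : G.edgeSet → ℤ} {k : ℤ} {n : ℕ} (h : n < rank w k) :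
    ∃ l ∈ matchingWeights w, l < k ∧ rank w l = n := by
  obtain ⟨d, hd⟩ := Nat.exists_eq_add_of_le (Nat.succ_le_of_lt h)
  induction d generalizing k with
  | zero =>
    obtain ⟨l, hl, hlk, hr⟩ := exists_rank_eq_add_one (by omega : 0 < rank w k)
    exact ⟨l, hl, hlk, by omega⟩
  | succ d ih =>
    obtain ⟨l, -, hlk, hr⟩ := exists_rank_eq_add_one (by omega : 0 < rank w k)
    obtain ⟨l', hl', hlt, hr'⟩ := ih (k := l) (by omega) (by omega)
    exact ⟨l', hl', hlt.trans hlk, hr'⟩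

/-- By induction the matchings still eligible at stage `ℓ` are those with `ℓ ≤ rank + 1`. The shift
by one appears because `ℓ` starts at `1` and ranks at `0`. -/
theorem isSmallest_iff {w : G.edgeSet → ℤ} {ℓ : ℕ} {M : Finset G.edgeSet} :
    IsSmallest w ℓ M ↔ IsPerfectMatching M ∧ rank w (weight w M) + 1 = ℓ := by
  induction ℓ using Nat.strong_induction_on generalizing M with
  | _ ℓ ih =>
  have hcand : ∀ N : Finset G.edgeSet,
      (IsPerfectMatching N ∧ ∀ ℓ' : ℕ, (_ : ℓ' < ℓ) → ¬ IsSmallest w ℓ' N) ↔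
        IsPerfectMatching N ∧ ℓ ≤ rank w (weight w N) + 1 := by
    refine fun N => and_congr_right fun hN => ⟨fun h => ?_, fun h ℓ' hℓ' hs => ?_⟩
    · by_contra! hlt
      exact h _ hlt ((ih _ hlt).2 ⟨hN, rfl⟩)
    · have := ((ih ℓ' hℓ').1 hs).2
      omega
  rw [IsSmallest]
  simp only [hcand]
  constructor
  · rintro ⟨h1, ⟨hM, hr⟩, hmin⟩
    refine ⟨hM, le_antisymm ?_ hr⟩
    by_contra! hlt
    obtain ⟨l, ⟨N, hN, hNl⟩, hl, hrl⟩ :=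
      exists_rank_eq_add_one (w := w) (k := weight w M) (by omega)
    have := hmin N ⟨hN, by rw [hNl]; omega⟩
    omega
  · rintro ⟨hM, hr⟩
    refine ⟨by omega, ⟨hM, hr.ge⟩, fun N ⟨hN, hrN⟩ => ?_⟩
    by_contra! hlt
    have := rank_lt ⟨N, hN, rfl⟩ hlt
    omega

/-- Greedy invariant: after `j` rounds, a matching containing `F` and lighter than `M` has rank at
least `j`. -/
lemma exists_subset_le_rank {w : G.edgeSet → ℤ} {M : Finset G.edgeSet} (hM : IsPerfectMatching M)
    (j : ℕ) : ∃ F ⊆ M, F.card ≤ 2 * j ∧ ∀ N, IsPerfectMatching N → F ⊆ N →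
      weight w M ≤ weight w N ∨ j ≤ rank w (weight w N) := by
  classical
  induction j with
  | zero => exact ⟨∅, by simp, by simp, fun N _ _ => Or.inr (Nat.zero_le _)⟩
  | succ j ih =>
    obtain ⟨F, hFM, hcard, hF⟩ := ih
    obtain ⟨N₁, ⟨hN₁, hFN₁⟩, hmin⟩ := Set.exists_min_image
      {N : Finset G.edgeSet | IsPerfectMatching N ∧ F ⊆ N} (weight w) (Set.toFinite _) ⟨M, hM, hFM⟩
    rcases le_or_gt (weight w M) (weight w N₁) with hle | hlt
    · exact ⟨F, hFM, by omega, fun N hN hFN => Or.inl (hle.trans (hmin N ⟨hN, hFN⟩))⟩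
    · obtain ⟨e, he, f, hf, hef⟩ := exists_pair_weight_lt hM hFM
        (fun N hN hFN => hmin N ⟨hN, hFN⟩) hlt
      refine ⟨insert e (insert f F), ?_, ?_, fun N hN hFN => Or.inr ?_⟩
      · simp [Finset.insert_subset_iff, he, hf, hFM]
      · have h1 := Finset.card_insert_le e (insert f F)
        have h2 := Finset.card_insert_le f F
        omega
      · simp only [Finset.insert_subset_iff] at hFN
        -- The new pair makes `N` strictly heavier than the old minimum `N₁`, whose rank was already
        -- at least `j`.
        have h1 := rank_lt ⟨N₁, hN₁, rfl⟩ (hef N hN hFN.2.2 hFN.1 hFN.2.1)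
        have h2 := (hF N₁ hN₁ hFN₁).resolve_left hlt.not_ge
        omega

theorem exists_isLeast_weightsContaining {w : G.edgeSet → ℤ} {M : Finset G.edgeSet}
    (hM : IsPerfectMatching M) : ∃ F : Finset G.edgeSet, F.card ≤ 2 * rank w (weight w M) ∧
      IsLeast (weightsContaining w F) (weight w M) := by
  obtain ⟨F, hFM, hcard, hF⟩ := exists_subset_le_rank (w := w) hM (rank w (weight w M))
  refine ⟨F, hcard, ⟨M, hM, hFM, rfl⟩, ?_⟩
  rintro k ⟨N, hN, hFN, rfl⟩
  by_contra! hlt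
  have h1 := (hF N hN hFN).resolve_left hlt.not_ge
  have h2 := rank_lt ⟨N, hN, rfl⟩ hlt
  omega

lemma mem_minWeights {w : G.edgeSet → ℤ} {k : ℤ} (hk : k ∈ matchingWeights w) {s : ℕ}
    (hs : rank w k ≤ s) : k ∈ minWeights w (2 * s) := by
  obtain ⟨M, hM, rfl⟩ := hk
  obtain ⟨F, hcard, hF⟩ := exists_isLeast_weightsContaining (w := w) hM
  exact ⟨F, by omega, hF⟩

/-- Weights below `k` have rank at most `s` as well, so the enumeration misses none of them. -/
lemma minWeights_lt_eq {w : G.edgeSet → ℤ} {k : ℤ} {s : ℕ} (hs : rank w k ≤ s) :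
    {c ∈ minWeights w (2 * s) | c < k} = {c ∈ matchingWeights w | c < k} := by
  ext c
  exact ⟨fun h => ⟨minWeights_subset w _ h.1, h.2⟩,
    fun h => ⟨mem_minWeights h.1 ((rank_mono w h.2.le).trans hs), h.2⟩⟩

lemma encard_matchingWeights_lt (w : G.edgeSet → ℤ) (k : ℤ) :
    {c ∈ matchingWeights w | c < k}.encard = rank w k :=
  ((matchingWeights_lt_finite w k).cast_ncard_eq).symm

theorem exists_isSmallest_iff (w : G.edgeSet → ℤ) (s : ℕ) (k : ℤ) :
    (∃ M, IsSmallest w (s + 1) M ∧ weight w M = k) ↔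
      k ∈ minWeights w (2 * s) ∧ {c ∈ minWeights w (2 * s) | c < k}.encard = s := by
  constructor
  · rintro ⟨M, hM, rfl⟩
    obtain ⟨hM, hr⟩ := isSmallest_iff.1 hM
    have hr' : rank w (weight w M) = s := by omega
    refine ⟨mem_minWeights ⟨M, hM, rfl⟩ hr'.le, ?_⟩
    rw [minWeights_lt_eq hr'.le, encard_matchingWeights_lt, hr']
  · rintro ⟨hk, hcard⟩
    -- Otherwise the weights of ranks `0` to `s` would all be enumerated and lie below `k`, which is
    -- `s + 1` values.
    have hr : rank w k ≤ s := by
      by_contra! hlt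
      obtain ⟨l, hl, hlk, hrl⟩ := exists_rank_eq hlt
      have hsub : insert l {c ∈ minWeights w (2 * s) | c < l} ⊆
          {c ∈ minWeights w (2 * s) | c < k} := by
        rintro c (rfl | hc)
        exacts [⟨mem_minWeights hl hrl.le, hlk⟩, ⟨hc.1, hc.2.trans hlk⟩]
      have := Set.encard_le_encard hsub
      rw [hcard, Set.encard_insert_of_notMem fun h => lt_irrefl _ h.2, minWeights_lt_eq hrl.le,
        encard_matchingWeights_lt, hrl] at this
      norm_cast at this
      omega
    rw [minWeights_lt_eq hr, encard_matchingWeights_lt] at hcard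
    norm_cast at hcard
    obtain ⟨M, hM, rfl⟩ := minWeights_subset w _ hk
    exact ⟨M, isSmallest_iff.2 ⟨hM, by omega⟩, rfl⟩

end Graph

/-- A set of at most `s` elements is listed in `s` slots, with unused slots set to `none`. -/
lemma encard_finset_card_le {α : Type*} [Finite α] (s : ℕ) :
    {F : Finset α | F.card ≤ s}.encard ≤ (ENat.card α + 1) ^ s := by
  classical
  have := Fintype.ofFinite α
  let g : (Fin s → Option α) → Finset α := fun t => Finset.univ.filter fun x => ∃ i, t i = some x
  have hsub : {F : Finset α | F.card ≤ s} ⊆ Set.range g := by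
    intro F hF
    refine ⟨fun i => if h : (i : ℕ) < F.card then some (F.equivFin.symm ⟨i, h⟩) else none, ?_⟩
    ext x
    simp only [g, Finset.mem_filter, Finset.mem_univ, true_and]
    constructor
    · rintro ⟨i, hi⟩
      split_ifs at hi
      rw [← Option.some_injective _ hi]
      exact (F.equivFin.symm _).2
    · intro hx
      refine ⟨⟨F.equivFin ⟨x, hx⟩, (F.equivFin ⟨x, hx⟩).2.trans_le hF⟩, ?_⟩
      rw [dif_pos (F.equivFin ⟨x, hx⟩).2]
      simp
  refine (Set.encard_le_encard hsub).trans ?_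
  rw [← Set.image_univ]
  refine (Set.encard_image_le g Set.univ).trans (le_of_eq ?_)
  rw [Set.encard_univ]
  simp [ENat.card_eq_coe_fintype_card]

/-! ### Tightness: disjoint triangular prisms -/

section Prism

/-- The edges of the triangular prism: the rungs, and the sides of the two triangles, indexed by
the opposite vertex. -/
abbrev PrismEdge := Fin 3 ⊕ Fin 3 × Bool

/-- The ends of an edge of the triangular prism. -/
def prismEnds : PrismEdge → Sym2 (Fin 3 × Bool)
  | .inl x => s((x, false), (x, true))
  | .inr (x, s) => s((x + 1, s), (x + 2, s))

lemma mem_prismEnds_inl {x y : Fin 3} {t : Bool} : (y, t) ∈ prismEnds (.inl x) ↔ y = x := by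
  revert x y t; decide

lemma mem_prismEnds_inr {x y : Fin 3} {s t : Bool} :
    (y, t) ∈ prismEnds (.inr (x, s)) ↔ t = s ∧ y ≠ x := by
  revert x y s t; decide

lemma prismEnds_injective : Function.Injective prismEnds := by
  unfold Function.Injective; decide

lemma not_isDiag_prismEnds : ∀ e, ¬ (prismEnds e).IsDiag := by
  decide

variable {m : ℕ} {V : Type*} (φ : Fin m × Fin 3 × Bool ≃ V)

/-- The ends of an edge of the disjoint union of `m` prisms, on vertices labelled by `φ`. -/
def prismsEnds (d : Fin m × PrismEdge) : Sym2 V := (prismEnds d.2).map fun p => φ (d.1, p)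

lemma mem_prismsEnds {i : Fin m} {p : Fin 3 × Bool} {d : Fin m × PrismEdge} :
    φ (i, p) ∈ prismsEnds φ d ↔ i = d.1 ∧ p ∈ prismEnds d.2 := by
  rw [prismsEnds, Sym2.mem_map]
  constructor
  · rintro ⟨q, hq, h⟩
    obtain ⟨h1, h2⟩ := Prod.ext_iff.1 (φ.injective h)
    exact ⟨h1.symm, (show q = p from h2) ▸ hq⟩
  · rintro ⟨rfl, hp⟩
    exact ⟨p, hp, rfl⟩

lemma prismsEnds_injective : Function.Injective (prismsEnds φ) := by
  rintro ⟨i, d⟩ ⟨j, e⟩ h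
  have hmem : ∀ k p, (k = i ∧ p ∈ prismEnds d) ↔ (k = j ∧ p ∈ prismEnds e) := fun k p => by
    rw [← mem_prismsEnds φ (d := (i, d)), ← mem_prismsEnds φ (d := (j, e)), h]
  obtain rfl : i = j := ((hmem i _).1 ⟨rfl, Sym2.out_fst_mem _⟩).1
  refine Prod.ext rfl (prismEnds_injective (Sym2.ext fun p => ?_))
  simpa using hmem i p

lemma not_isDiag_prismsEnds (d : Fin m × PrismEdge) : ¬ (prismsEnds φ d).IsDiag := by
  rw [prismsEnds, Sym2.isDiag_map fun p q h => (Prod.ext_iff.1 (φ.injective h)).2]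
  exact not_isDiag_prismEnds d.2

/-- The disjoint union of `m` triangular prisms. -/
def prismGraph : SimpleGraph V := SimpleGraph.fromEdgeSet (Set.range (prismsEnds φ))

/-- The edges of the disjoint union of `m` triangular prisms. -/
noncomputable def prismEdgeEquiv : Fin m × PrismEdge ≃ (prismGraph φ).edgeSet :=
  Equiv.ofBijective (fun d => ⟨prismsEnds φ d, by
    rw [prismGraph, SimpleGraph.edgeSet_fromEdgeSet]
    exact ⟨⟨d, rfl⟩, not_isDiag_prismsEnds φ d⟩⟩) <| by
    refine ⟨fun d e h => prismsEnds_injective φ (congrArg Subtype.val h), ?_⟩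
    rintro ⟨e, he⟩
    have he' := he
    rw [prismGraph, SimpleGraph.edgeSet_fromEdgeSet] at he'
    obtain ⟨d, hd⟩ := he'.1
    exact ⟨d, Subtype.ext hd⟩

lemma prismEdgeEquiv_coe (d : Fin m × PrismEdge) :
    (prismEdgeEquiv φ d : Sym2 V) = prismsEnds φ d := rfl

/-- The weights that are `1` on the rungs and `0` on the triangles. -/
noncomputable def rungWeight (e : (prismGraph φ).edgeSet) : ℤ :=
  if ((prismEdgeEquiv φ).symm e).2.isLeft then 1 else 0

variable {φ}

lemma isPerfectMatching_prismGraph {N : Finset (prismGraph φ).edgeSet} :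
    IsPerfectMatching N ↔
      ∀ i p, ∃! d : PrismEdge, prismEdgeEquiv φ (i, d) ∈ N ∧ p ∈ prismEnds d := by
  rw [IsPerfectMatching, φ.forall_congr_right.symm, Prod.forall]
  refine forall_congr' fun i => forall_congr' fun p => ?_
  rw [← (prismEdgeEquiv φ).existsUnique_congr_right]
  simp only [prismEdgeEquiv_coe, mem_prismsEnds]
  constructor
  · rintro ⟨⟨j, d⟩, ⟨hd, rfl, hp⟩, hu⟩
    exact ⟨d, ⟨hd, hp⟩, fun e he => (Prod.ext_iff.1 (hu (i, e) ⟨he.1, rfl, he.2⟩)).2⟩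
  · rintro ⟨d, ⟨hd, hp⟩, hu⟩
    refine ⟨(i, d), ⟨hd, rfl, hp⟩, ?_⟩
    rintro ⟨j, e⟩ ⟨he, rfl, hpe⟩
    exact Prod.ext rfl (hu e ⟨he, hpe⟩)

open scoped Classical in
/-- The number of rungs of the `i`-th prism in `N`. -/
noncomputable def rungCount (N : Finset (prismGraph φ).edgeSet) (i : Fin m) : ℕ :=
  (Finset.univ.filter fun x : Fin 3 => prismEdgeEquiv φ (i, .inl x) ∈ N).card

lemma weight_rungWeight (N : Finset (prismGraph φ).edgeSet) :
    weight (rungWeight φ) N = ∑ i, (rungCount N i : ℤ) := by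
  classical
  have := Fintype.ofEquiv _ (prismEdgeEquiv φ)
  have h1 : weight (rungWeight φ) N = ∑ e, if e ∈ N then rungWeight φ e else 0 := by
    simp [weight]
  rw [h1, ← (prismEdgeEquiv φ).sum_comp, Fintype.sum_prod_type]
  refine Finset.sum_congr rfl fun i _ => ?_
  rw [Fintype.sum_sum_type]
  simp [rungWeight, rungCount]

lemma rungCount_le (N : Finset (prismGraph φ).edgeSet) (i : Fin m) : rungCount N i ≤ 3 := by
  classical
  exact (Finset.card_le_univ _).trans_eq (by simp)

lemma forall_mem_of_rungCount_eq {N : Finset (prismGraph φ).edgeSet} {i : Fin m}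
    (h : rungCount N i = 3) (x : Fin 3) : prismEdgeEquiv φ (i, .inl x) ∈ N := by
  classical
  have := (Finset.card_eq_iff_eq_univ _).1 (h.trans (by simp))
  simpa using this.ge (Finset.mem_univ x)

/-- If a rung is missing, its vertex in the `false` triangle is matched along the side opposite some
`y`. That side excludes the rungs at both its ends, and since two sides of a triangle meet, `y` must
use its rung. -/
lemma IsPerfectMatching.rungCount_eq {N : Finset (prismGraph φ).edgeSet}
    (hN : IsPerfectMatching N) (i : Fin m) : rungCount N i = 1 ∨ rungCount N i = 3 := by
  classical
  rw [isPerfectMatching_prismGraph] at hN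
  by_cases hall : ∀ x, prismEdgeEquiv φ (i, .inl x) ∈ N
  · right
    simp [rungCount, hall]
  · left
    push Not at hall
    obtain ⟨x, hx⟩ := hall
    obtain ⟨d, ⟨hd, hdx⟩, -⟩ := hN i (x, false)
    rcases d with y | ⟨y, s⟩
    · rw [mem_prismEnds_inl] at hdx
      exact absurd (hdx ▸ hd) hx
    obtain ⟨rfl, hxy⟩ := mem_prismEnds_inr.1 hdx
    have hne : ∀ z, z ≠ y → prismEdgeEquiv φ (i, .inl z) ∉ N := fun z hz hmem => by
      have := (hN i (z, false)).unique ⟨hmem, mem_prismEnds_inl.2 rfl⟩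
        ⟨hd, mem_prismEnds_inr.2 ⟨rfl, hz⟩⟩
      simp at this
    have hy : prismEdgeEquiv φ (i, .inl y) ∈ N := by
      obtain ⟨e, ⟨he, hey⟩, -⟩ := hN i (y, false)
      rcases e with z | ⟨z, s⟩
      · rw [mem_prismEnds_inl] at hey
        exact hey ▸ he
      · obtain ⟨rfl, hyz⟩ := mem_prismEnds_inr.1 hey
        obtain ⟨t, hty, htz⟩ : ∃ t : Fin 3, t ≠ y ∧ t ≠ z := by
          clear * -
          revert y z; decide
        have := (hN i (t, false)).unique ⟨hd, mem_prismEnds_inr.2 ⟨rfl, hty⟩⟩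
          ⟨he, mem_prismEnds_inr.2 ⟨rfl, htz⟩⟩
        simp only [Sum.inr.injEq, Prod.mk.injEq, and_true] at this
        exact absurd this hyz
    rw [rungCount, Finset.card_eq_one]
    refine ⟨y, Finset.ext fun z => ?_⟩
    simp only [Finset.mem_filter, Finset.mem_univ, true_and, Finset.mem_singleton]
    exact ⟨fun h => by_contra fun hz => hne z hz h, fun h => h ▸ hy⟩

/-- The edges of a perfect matching of the prism: all rungs for `none`, and for `some x` the rung
at `x` and the two triangle sides opposite to `x`. -/
def prismChoice : Option (Fin 3) → PrismEdge → Bool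
  | none, .inl _ => true
  | none, .inr _ => false
  | some x, .inl y => x = y
  | some x, .inr (y, _) => x = y

lemma existsUnique_prismChoice (o : Option (Fin 3)) (p : Fin 3 × Bool) :
    ∃! d : PrismEdge, prismChoice o d ∧ p ∈ prismEnds d := by
  obtain ⟨y, s⟩ := p
  rcases o with _ | x
  · refine ⟨.inl y, ⟨rfl, mem_prismEnds_inl.2 rfl⟩, ?_⟩
    rintro (z | z) ⟨h, hz⟩
    · rw [mem_prismEnds_inl.1 hz]
    · simp [prismChoice] at h
  · by_cases hxy : y = x
    · refine ⟨.inl y, ⟨by simp [prismChoice, hxy], mem_prismEnds_inl.2 rfl⟩, ?_⟩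
      rintro (z | ⟨z, t⟩) ⟨h, hz⟩
      · rw [mem_prismEnds_inl.1 hz]
      · simp only [prismChoice, decide_eq_true_eq] at h
        exact absurd (hxy.trans h) (mem_prismEnds_inr.1 hz).2
    · refine ⟨.inr (x, s), ⟨by simp [prismChoice], mem_prismEnds_inr.2 ⟨rfl, hxy⟩⟩, ?_⟩
      rintro (z | ⟨z, t⟩) ⟨h, hz⟩ <;> simp only [prismChoice, decide_eq_true_eq] at h
      · exact absurd ((mem_prismEnds_inl.1 hz).trans h.symm) hxy
      · rw [← h, (mem_prismEnds_inr.1 hz).1]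

variable (φ) in
open scoped Classical in
/-- The perfect matching of the disjoint union of `m` prisms given by the choices `f`. -/
noncomputable def prismMatching (f : Fin m → Option (Fin 3)) : Finset (prismGraph φ).edgeSet :=
  (Finset.univ.filter fun d : Fin m × PrismEdge => prismChoice (f d.1) d.2).map
    (prismEdgeEquiv φ).toEmbedding

lemma mem_prismMatching {f : Fin m → Option (Fin 3)} {i : Fin m} {d : PrismEdge} :
    prismEdgeEquiv φ (i, d) ∈ prismMatching φ f ↔ prismChoice (f i) d := by
  simp [prismMatching]

lemma isPerfectMatching_prismMatching (f : Fin m → Option (Fin 3)) :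
    IsPerfectMatching (prismMatching φ f) := by
  rw [isPerfectMatching_prismGraph]
  intro i p
  simpa only [mem_prismMatching] using existsUnique_prismChoice (f i) p

lemma rungCount_prismMatching (f : Fin m → Option (Fin 3)) (i : Fin m) :
    rungCount (prismMatching φ f) i = if f i = none then 3 else 1 := by
  classical
  rw [rungCount]
  simp only [mem_prismMatching]
  rcases h : f i with _ | x
  · simp [prismChoice]
  · simp [prismChoice, Finset.filter_eq]

lemma weight_prismMatching (f : Fin m → Option (Fin 3)) :
    weight (rungWeight φ) (prismMatching φ f) = ∑ i, if f i = none then 3 else 1 := by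
  rw [weight_rungWeight]
  refine Finset.sum_congr rfl fun i _ => ?_
  rw [rungCount_prismMatching]
  split_ifs <;> rfl

-- With all rungs in `j` prisms and one rung in each of the others, the weight is `3j + (m - j) = m
-- + 2j`.
variable (φ) in
lemma matchingWeights_lt_prismGraph :
    {c ∈ matchingWeights (rungWeight φ) | c < 3 * m} =
      (fun j : ℕ => (m + 2 * j : ℤ)) '' (Finset.range m : Set ℕ) := by
  classical
  ext c
  simp only [Set.mem_image, Finset.coe_range, Set.mem_Iio]
  constructor
  · rintro ⟨⟨N, hN, rfl⟩, hlt⟩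
    have h : weight (rungWeight φ) N =
        m + 2 * (Finset.univ.filter fun i => rungCount N i = 3).card := by
      rw [weight_rungWeight, Finset.card_filter]
      push_cast
      rw [Finset.mul_sum]
      have hm : (m : ℤ) = ∑ i : Fin m, 1 := by simp
      rw [hm, ← Finset.sum_add_distrib]
      refine Finset.sum_congr rfl fun i _ => ?_
      rcases hN.rungCount_eq i with h | h <;> simp [h]
    exact ⟨_, by omega, h.symm⟩
  · rintro ⟨j, hj, rfl⟩
    refine ⟨⟨prismMatching φ fun i => if (i : ℕ) < j then none else some 0,
      isPerfectMatching_prismMatching _, ?_⟩, by omega⟩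
    have h : ∀ i : Fin m, (if (if (i : ℕ) < j then none else some (0 : Fin 3)) = none then
        (3 : ℤ) else 1) = 1 + 2 * if (i : ℕ) < j then 1 else 0 := by
      intro i
      split_ifs <;> simp_all
    rw [weight_prismMatching]
    simp only [h]
    rw [Finset.sum_add_distrib, ← Finset.mul_sum,
      Fin.sum_univ_eq_sum_range (fun i => if i < j then (1 : ℤ) else 0), ← Finset.sum_filter]
    have hf : (Finset.range m).filter (· < j) = Finset.range j := by
      ext i
      simp only [Finset.mem_filter, Finset.mem_range]
      omega
    simp [hf]

variable (φ) in
lemma weight_prismMatching_none :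
    weight (rungWeight φ) (prismMatching φ fun _ => none) = 3 * m := by
  rw [weight_prismMatching]
  simp [mul_comm]

variable (φ) in
lemma isSmallest_prismMatching_none [Finite V] :
    IsSmallest (rungWeight φ) (m + 1) (prismMatching φ fun _ => none) := by
  refine isSmallest_iff.2 ⟨isPerfectMatching_prismMatching _, ?_⟩
  rw [weight_prismMatching_none, rank, matchingWeights_lt_prismGraph,
    Set.ncard_image_of_injective _ fun i j h => by simpa using h, Set.ncard_coe_finset,
    Finset.card_range]

lemma weight_rungWeight_le_card (F : Finset (prismGraph φ).edgeSet) :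
    weight (rungWeight φ) F ≤ F.card := by
  rw [weight, Finset.card_eq_sum_ones, Nat.cast_sum]
  refine Finset.sum_le_sum fun e _ => ?_
  unfold rungWeight
  split_ifs <;> norm_num

/-- If `F` has at most one rung in some prism, the matching there can be replaced by a one-rung
matching keeping it, which saves weight. So `F` needs two rungs in every prism. -/
lemma two_mul_le_card_of_isLeast {F : Finset (prismGraph φ).edgeSet}
    (hF : IsLeast (weightsContaining (rungWeight φ) F) (3 * m)) : 2 * m ≤ F.card := by
  classical
  obtain ⟨⟨N, hN, hFN, hw⟩, hmin⟩ := hF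
  have hthree : ∀ i, rungCount N i = 3 := by
    have h : ∑ i, (rungCount N i : ℤ) = ∑ _i : Fin m, 3 := by
      rw [← weight_rungWeight, hw]
      simp [mul_comm]
    rw [Finset.sum_eq_sum_iff_of_le fun i _ => by exact_mod_cast rungCount_le N i] at h
    exact fun i => by exact_mod_cast h i (Finset.mem_univ i)
  -- With all rungs present no triangle side fits, so `F ⊆ N` consists of rungs only.
  have hinr : ∀ i x s, prismEdgeEquiv φ (i, .inr (x, s)) ∉ N := by
    intro i x s hmem
    have := (isPerfectMatching_prismGraph.1 hN i (x + 1, s)).unique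
      ⟨hmem, mem_prismEnds_inr.2 ⟨rfl, by simp⟩⟩
      ⟨forall_mem_of_rungCount_eq (hthree i) (x + 1), mem_prismEnds_inl.2 rfl⟩
    simp at this
  by_contra! hlt
  obtain ⟨i, hi⟩ : ∃ i, rungCount F i ≤ 1 := by
    by_contra! hall
    have h1 : (2 * m : ℤ) ≤ ∑ i, (rungCount F i : ℤ) := by
      have := Finset.sum_le_sum (s := Finset.univ) fun i (_ : i ∈ Finset.univ) =>
        (by exact_mod_cast hall i : (2 : ℤ) ≤ rungCount F i)
      simpa [mul_comm] using this
    rw [← weight_rungWeight] at h1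
    have := weight_rungWeight_le_card F
    omega
  obtain ⟨x, hx⟩ : ∃ x, ∀ y, prismEdgeEquiv φ (i, .inl y) ∈ F → y = x := by
    obtain ⟨x, hx⟩ := Finset.card_le_one_iff_subset_singleton.1 hi
    exact ⟨x, fun y hy => by simpa using hx (Finset.mem_filter.2 ⟨Finset.mem_univ y, hy⟩)⟩
  have hsub : F ⊆ prismMatching φ (Function.update (fun _ => none) i (some x)) := by
    intro e he
    obtain ⟨⟨j, d⟩, rfl⟩ := (prismEdgeEquiv φ).surjective e
    rw [mem_prismMatching]
    rcases d with y | ⟨y, s⟩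
    · by_cases hj : j = i
      · subst hj
        simp [prismChoice, hx y he]
      · simp [prismChoice, hj]
    · exact absurd (hFN he) (hinr j y s)
  have hle := hmin ⟨_, isPerfectMatching_prismMatching _, hsub, rfl⟩
  rw [weight_prismMatching] at hle
  have hlt' : ∑ j, (if Function.update (fun _ => none) i (some x) j = none then (3 : ℤ) else 1) <
      ∑ _j : Fin m, 3 := by
    refine Finset.sum_lt_sum (fun j _ => by split_ifs <;> norm_num) ⟨i, Finset.mem_univ i, ?_⟩
    simp
  simp only [Finset.sum_const, Finset.card_univ, Fintype.card_fin, nsmul_eq_mul] at hlt'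
  linarith

/-- The bound on the number of prescribed edges is attained on disjoint unions of prisms. -/
theorem exists_isSmallest_forall_two_mul_le_card (m : ℕ) :
    ∃ (n : ℕ) (G : SimpleGraph (Fin n)) (w : G.edgeSet → ℤ) (M : Finset G.edgeSet),
      IsSmallest w (m + 1) M ∧ ∀ F : Finset G.edgeSet,
        IsLeast (weightsContaining w F) (weight w M) → 2 * m ≤ F.card := by
  let φ : Fin m × Fin 3 × Bool ≃ Fin _ := Fintype.equivFin _
  refine ⟨_, prismGraph φ, rungWeight φ, prismMatching φ fun _ => none,
    isSmallest_prismMatching_none φ, fun F hF => ?_⟩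
  rw [weight_prismMatching_none] at hF
  exact two_mul_le_card_of_isLeast hF

end Prism

end SmallestPM

theorem theorem3p3 (ℓ : ℕ) (hℓ : 1 ≤ ℓ) :
    -- for every finite simple graph with integer edge weights
    (∀ (V : Type*) [Finite V] (G : SimpleGraph V) (w : G.edgeSet → ℤ),
      -- at most `2(ℓ - 1)` edges suffice to find an `ℓ`-th smallest perfect matching
      (∀ M : Finset G.edgeSet, SmallestPM.IsSmallest w ℓ M →
        ∃ F : Finset G.edgeSet, F.card ≤ 2 * (ℓ - 1) ∧
          IsLeast (SmallestPM.weightsContaining w F) (SmallestPM.weight w M)) ∧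
      -- correctness of the enumeration for the `ℓ`-th smallest perfect matching problem
      (∀ k : ℤ,
        (∃ M : Finset G.edgeSet, SmallestPM.IsSmallest w ℓ M ∧ SmallestPM.weight w M = k) ↔
          k ∈ SmallestPM.minWeights w (2 * (ℓ - 1)) ∧
            {c ∈ SmallestPM.minWeights w (2 * (ℓ - 1)) | c < k}.encard + 1 = ℓ) ∧
      -- correctness of the enumeration for the exact-weight perfect matching problem
      (∀ k : ℤ,
        (∀ M : Finset G.edgeSet, SmallestPM.IsPerfectMatching M → SmallestPM.weight w M = k →
          ∃ ℓ' : ℕ, ℓ' ≤ ℓ ∧ SmallestPM.IsSmallest w ℓ' M) →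
        ((∃ M : Finset G.edgeSet, SmallestPM.IsPerfectMatching M ∧ SmallestPM.weight w M = k) ↔
          k ∈ SmallestPM.minWeights w (2 * (ℓ - 1)))) ∧
      -- the number of edge sets in the enumeration
      {F : Finset G.edgeSet | F.card ≤ 2 * (ℓ - 1)}.encard ≤
        (G.edgeSet.encard + 1) ^ (2 * (ℓ - 1))) ∧
    -- the bound `2(ℓ - 1)` is tight
    (∃ (n : ℕ) (G : SimpleGraph (Fin n)) (w : G.edgeSet → ℤ) (M : Finset G.edgeSet),
      SmallestPM.IsSmallest w ℓ M ∧
        ∀ F : Finset G.edgeSet,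
          IsLeast (SmallestPM.weightsContaining w F) (SmallestPM.weight w M) →
            2 * (ℓ - 1) ≤ F.card) := by
  obtain ⟨s, rfl⟩ := Nat.exists_eq_add_of_le' hℓ
  rw [Nat.add_sub_cancel]
  refine ⟨fun V _ G w => ⟨fun M hM => ?_, fun k => ?_, fun k hk => ?_, ?_⟩,
    SmallestPM.exists_isSmallest_forall_two_mul_le_card s⟩
  · obtain ⟨hPM, hr⟩ := SmallestPM.isSmallest_iff.1 hM
    obtain rfl : SmallestPM.rank w (SmallestPM.weight w M) = s := by omega
    exact SmallestPM.exists_isLeast_weightsContaining hPM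
  · rw [SmallestPM.exists_isSmallest_iff, Nat.cast_add_one,
      (ENat.add_left_injective_of_ne_top ENat.one_ne_top).eq_iff]
  · refine ⟨?_, fun h => SmallestPM.minWeights_subset w _ h⟩
    rintro ⟨M, hM, hMk⟩
    obtain ⟨ℓ', hle, hs⟩ := hk M hM hMk
    have hr := (SmallestPM.isSmallest_iff.1 hs).2
    rw [hMk] at hr
    exact SmallestPM.mem_minWeights ⟨M, hM, hMk⟩ (by omega)
  · exact SmallestPM.encard_finset_card_le _
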